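/- Let $\tau\in\mathbb R$. Let $\mathbb D^2=\{(x,y)\in\mathbb R^2: x^2+y^2<1\}$ and $\lambda=\frac{2}{1-(x^2+y^2)}$, and let $\widetilde{PSL}_2(\mathbb R,\tau)$ be $\mathbb D^2\times\mathbb R$ with coordinates $(x,y,t)$ and the Riemannian metric $$\lambda^2(dx^2+dy^2)+\Big(2\tau\Big(\frac{\lambda_y}{\lambda}\,dx-\frac{\lambda_x}{\lambda}\,dy\Big)+dt\Big)^2 .$$ An entire graph is a surface $\{(x,y,u(x,y)):(x,y)\in\mathbb D^2\}$ with $u:\mathbb D^2\to\mathbb R$ of class $C^2$ (in particular, $u$ may be smooth). The mean curvature of a surface with respect to a continuous unit normal field $N$ is one half of the trace, with respect to the induced metric, of its second fundamental form in the direction $N$. Proposition. If $H>1/2$, then there is no entire graph in $\widetilde{PSL}_2(\mathbb R,\tau)$ that has constant mean curvature $H$ with respect to one of its two continuous unit normal fields. -/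

import Mathlib

noncomputable section

namespace PSL2

/-! ### Surfaces in a Riemannian 3-manifold with one global chart

A Riemannian metric on an open subset of `ℝ³` is given as `g : p ↦ g_p(v, w)`.  A parametrized
surface is a map `φ` from (an open subset of) the plane `Fin 2 → ℝ` to `Fin 3 → ℝ`. -/

/-- The Christoffel symbol of the first kind, `Γ_{ab,c} = g(∇_{∂_a} ∂_b, ∂_c)`, where `∇` is the
Levi-Civita connection of `g` (this is the Koszul formula for coordinate fields). -/
def christoffel (g : (Fin 3 → ℝ) → (Fin 3 → ℝ) → (Fin 3 → ℝ) → ℝ) (a b c : Fin 3)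
    (p : Fin 3 → ℝ) : ℝ :=
  let e : Fin 3 → (Fin 3 → ℝ) := fun i => Pi.single i 1
  (1 / 2) * (fderiv ℝ (fun x => g x (e b) (e c)) p (e a)
    + fderiv ℝ (fun x => g x (e a) (e c)) p (e b)
    - fderiv ℝ (fun x => g x (e a) (e b)) p (e c))

/-- The coordinate tangent vector `∂_i φ` at the parameter `q`. -/
def tangent (φ : (Fin 2 → ℝ) → (Fin 3 → ℝ)) (i : Fin 2) (q : Fin 2 → ℝ) : Fin 3 → ℝ :=
  fderiv ℝ φ q (Pi.single i 1)

/-- The first fundamental form `I_{ij} = g(∂_i φ, ∂_j φ)`. -/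
def firstForm (g : (Fin 3 → ℝ) → (Fin 3 → ℝ) → (Fin 3 → ℝ) → ℝ)
    (φ : (Fin 2 → ℝ) → (Fin 3 → ℝ)) (q : Fin 2 → ℝ) : Matrix (Fin 2) (Fin 2) ℝ :=
  Matrix.of fun i j => g (φ q) (tangent φ i q) (tangent φ j q)

/-- The second fundamental form `II_{ij} = g(∇_{∂_i φ} ∂_j φ, n)` in the normal direction `n`,
that is `g(∂_i ∂_j φ, n) + ∑ Γ_{ab,c} (∂_i φ)^a (∂_j φ)^b n^c`. -/
def secondForm (g : (Fin 3 → ℝ) → (Fin 3 → ℝ) → (Fin 3 → ℝ) → ℝ)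
    (φ : (Fin 2 → ℝ) → (Fin 3 → ℝ)) (n : Fin 3 → ℝ) (q : Fin 2 → ℝ) :
    Matrix (Fin 2) (Fin 2) ℝ :=
  Matrix.of fun i j =>
    g (φ q) (fderiv ℝ (tangent φ j) q (Pi.single i 1)) n
      + ∑ a, ∑ b, ∑ c, christoffel g a b c (φ q) * tangent φ i q a * tangent φ j q b * n c

/-- The mean curvature at `q` of the immersion `φ` with respect to the unit normal `n`: one half of
the trace of the second fundamental form with respect to the first. -/
def meanCurvature (g : (Fin 3 → ℝ) → (Fin 3 → ℝ) → (Fin 3 → ℝ) → ℝ)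
    (φ : (Fin 2 → ℝ) → (Fin 3 → ℝ)) (n : Fin 3 → ℝ) (q : Fin 2 → ℝ) : ℝ :=
  (1 / 2) * ((firstForm g φ q)⁻¹ * secondForm g φ n q).trace

/-- The immersed surface `φ : U → (ℝ³, g)` has constant mean curvature `H`, for one of its
orientations: there is a continuous unit normal field `N` along `φ` with respect to which the mean
curvature is `H` everywhere. -/
def HasConstantMeanCurvature (g : (Fin 3 → ℝ) → (Fin 3 → ℝ) → (Fin 3 → ℝ) → ℝ)
    (U : Set (Fin 2 → ℝ)) (φ : (Fin 2 → ℝ) → (Fin 3 → ℝ)) (H : ℝ) : Prop :=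
  ∃ N : (Fin 2 → ℝ) → (Fin 3 → ℝ), ContinuousOn N U ∧ ∀ q ∈ U,
    g (φ q) (N q) (N q) = 1 ∧
    (∀ i, g (φ q) (tangent φ i q) (N q) = 0) ∧
    meanCurvature g φ (N q) q = H

/-! ### The space and its entire graphs -/

/-- The disk model of the hyperbolic plane (as a set). -/
def disk : Set (Fin 2 → ℝ) := {q | q 0 ^ 2 + q 1 ^ 2 < 1}

/-- The conformal factor of the hyperbolic metric of the disk. -/
def lam (x y : ℝ) : ℝ := 2 / (1 - (x ^ 2 + y ^ 2))

/-- The 1-form `2τ(λ_y/λ dx - λ_x/λ dy) + dt` at `p = (x, y, t)`. -/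
def connectionForm (τ : ℝ) (p v : Fin 3 → ℝ) : ℝ :=
  2 * τ * (deriv (fun y => lam (p 0) y) (p 1) / lam (p 0) (p 1) * v 0
    - deriv (fun x => lam x (p 1)) (p 0) / lam (p 0) (p 1) * v 1) + v 2

/-- The metric `λ²(dx² + dy²) + (2τ(λ_y/λ dx - λ_x/λ dy) + dt)²` of the universal cover of
`PSL₂(ℝ)` with parameter `τ`, on the points `(x, y, t)` with `(x, y)` in the unit disk. -/
def metric (τ : ℝ) (p v w : Fin 3 → ℝ) : ℝ :=
  lam (p 0) (p 1) ^ 2 * (v 0 * w 0 + v 1 * w 1)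
    + connectionForm τ p v * connectionForm τ p w

/-- The section `(x, y) ↦ (x, y, u(x, y))`, whose image over the disk is the entire graph of `u`. -/
def graphMap (u : (Fin 2 → ℝ) → ℝ) (q : Fin 2 → ℝ) : Fin 3 → ℝ := ![q 0, q 1, u q]

end PSL2

end

noncomputable section

namespace PSL2

open Set

/-! The proof is a flux argument. With `a = u_x + 2τλy`, `b = u_y - 2τλx` and `s = √(λ² + a² + b²)`,
the mean curvature equation of a graph takes the divergence form `div X = ± 2Hλ²` for the planar
field `X = λ(a, b)/s`, and `|X| ≤ λ` for every `u` and `τ` (`sq_divergence_flux`,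
`fluxX_sq_add_fluxY_sq_le`).

Integrate over the Euclidean disk of radius `R < 1`. As `dλ/dr = λ² r`, the left side below is the
integral of `2Hλ²`, and the bound on `X` controls the outward flux: `2H · 2πR²λ(R) ≤ 2πRλ(R)`, that
is `2HR ≤ 1`. This fails for `R` close to `1` when `2H > 1` (`false_of_divergence_eq`).

Only the square of the equation is computed, so that the choice of normal drops out. Since `2Hλ²`
has no zero, the sign is constant on the connected disk, and the negative sign is absorbed by
replacing `X` with `-X`. -/

/-! ### Derivatives of the conformal factor and of the metric. -/

theorem isOpen_disk : IsOpen disk :=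
  isOpen_lt (by fun_prop) continuous_const

theorem hasFDerivAt_lam {n : ℕ} (i j : Fin n) {p : Fin n → ℝ} (hp : p i ^ 2 + p j ^ 2 < 1) :
    HasFDerivAt (fun x : Fin n → ℝ => lam (x i) (x j))
      (lam (p i) (p j) ^ 2 • (p i • ContinuousLinearMap.proj (R := ℝ) (φ := fun _ => ℝ) i
        + p j • ContinuousLinearMap.proj (R := ℝ) (φ := fun _ => ℝ) j)) p := by
  have hD : (1 - (p i ^ 2 + p j ^ 2)) ≠ 0 := by linarith
  have hi : HasFDerivAt (fun x : Fin n → ℝ => x i)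
    (ContinuousLinearMap.proj (R := ℝ) (φ := fun _ => ℝ) i) p := hasFDerivAt_apply i p
  have hj : HasFDerivAt (fun x : Fin n → ℝ => x j)
    (ContinuousLinearMap.proj (R := ℝ) (φ := fun _ => ℝ) j) p := hasFDerivAt_apply j p
  have h := (hasDerivAt_inv hD).comp_hasFDerivAt p (((hi.pow 2).add (hj.pow 2)).const_sub 1)
  have h2 : HasFDerivAt (fun x : Fin n → ℝ => 2 * (1 - (x i ^ 2 + x j ^ 2))⁻¹) _ p := h.const_mul 2
  simp only [lam, div_eq_mul_inv]
  refine h2.congr_fderiv ?_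
  ext v
  simp
  field_simp
  ring

theorem deriv_lam_left {x y : ℝ} (h : x ^ 2 + y ^ 2 < 1) :
    deriv (fun x => lam x y) x = lam x y ^ 2 * x := by
  have hD : (1 - (x ^ 2 + y ^ 2)) ≠ 0 := by linarith
  have h1 := (((((hasDerivAt_id x).pow 2).add_const (y ^ 2)).const_sub 1).fun_inv hD).const_mul 2
  simp only [lam, div_eq_mul_inv]
  refine h1.deriv.trans ?_
  simp
  field_simp

theorem lam_comm (x y : ℝ) : lam x y = lam y x := by simp [lam, add_comm]

theorem deriv_lam_right {x y : ℝ} (h : x ^ 2 + y ^ 2 < 1) :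
    deriv (fun y => lam x y) y = lam x y ^ 2 * y := by
  simp only [lam_comm x]
  exact deriv_lam_left (by linarith)

theorem lam_pos {x y : ℝ} (h : x ^ 2 + y ^ 2 < 1) : 0 < lam x y :=
  div_pos two_pos (by linarith)

/-- Because `λ_x = λ²x` and `λ_y = λ²y`, the quotients reduce to `λx` and `λy`. The metric and its
derivatives thereby become polynomial in `λ` and the coordinates, which lets `ring` settle the later
identities. -/
theorem connectionForm_eq (τ : ℝ) {p : Fin 3 → ℝ} (hp : p 0 ^ 2 + p 1 ^ 2 < 1) (v : Fin 3 → ℝ) :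
    connectionForm τ p v = 2 * τ * (lam (p 0) (p 1) * (p 1 * v 0 - p 0 * v 1)) + v 2 := by
  have := (lam_pos hp).ne'
  rw [connectionForm, deriv_lam_left hp, deriv_lam_right hp]
  field_simp

theorem hasFDerivAt_connectionForm (τ : ℝ) {p : Fin 3 → ℝ} (hp : p 0 ^ 2 + p 1 ^ 2 < 1)
    (v : Fin 3 → ℝ) :
    ∃ f : (Fin 3 → ℝ) →L[ℝ] ℝ, HasFDerivAt (fun x => connectionForm τ x v) f p ∧
      ∀ h, f h = 2 * τ * (lam (p 0) (p 1) ^ 2 * (p 0 * h 0 + p 1 * h 1) * (p 1 * v 0 - p 0 * v 1)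
        + lam (p 0) (p 1) * (h 1 * v 0 - h 0 * v 1)) := by
  have hev : (fun x => connectionForm τ x v) =ᶠ[nhds p]
      fun x => 2 * τ * (lam (x 0) (x 1) * (x 1 * v 0 - x 0 * v 1)) + v 2 := by
    have ho : IsOpen {x : Fin 3 → ℝ | x 0 ^ 2 + x 1 ^ 2 < 1} :=
      isOpen_lt (by fun_prop) continuous_const
    filter_upwards [ho.mem_nhds hp] with x hx using connectionForm_eq τ hx v
  have h0 : HasFDerivAt (fun x : Fin 3 → ℝ => x 0)
    (ContinuousLinearMap.proj (R := ℝ) (φ := fun _ => ℝ) 0) p := hasFDerivAt_apply 0 p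
  have h1 : HasFDerivAt (fun x : Fin 3 → ℝ => x 1)
    (ContinuousLinearMap.proj (R := ℝ) (φ := fun _ => ℝ) 1) p := hasFDerivAt_apply 1 p
  have := ((((hasFDerivAt_lam 0 1 hp).mul ((h1.mul_const (v 0)).sub (h0.mul_const (v 1)))).const_mul
    (2 * τ)).add_const (v 2)).congr_of_eventuallyEq hev
  refine ⟨_, this, fun h => ?_⟩
  simp
  ring

/-- The derivative of `x ↦ g_x(v, w)` in the direction `h`. -/
def metricDeriv (τ : ℝ) (p v w h : Fin 3 → ℝ) : ℝ :=
  2 * lam (p 0) (p 1) ^ 3 * (p 0 * h 0 + p 1 * h 1) * (v 0 * w 0 + v 1 * w 1)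
    + 2 * τ * (lam (p 0) (p 1) ^ 2 * (p 0 * h 0 + p 1 * h 1) * (p 1 * v 0 - p 0 * v 1)
        + lam (p 0) (p 1) * (h 1 * v 0 - h 0 * v 1))
      * (2 * τ * (lam (p 0) (p 1) * (p 1 * w 0 - p 0 * w 1)) + w 2)
    + (2 * τ * (lam (p 0) (p 1) * (p 1 * v 0 - p 0 * v 1)) + v 2)
      * (2 * τ * (lam (p 0) (p 1) ^ 2 * (p 0 * h 0 + p 1 * h 1) * (p 1 * w 0 - p 0 * w 1)
        + lam (p 0) (p 1) * (h 1 * w 0 - h 0 * w 1)))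

theorem fderiv_metric (τ : ℝ) {p : Fin 3 → ℝ} (hp : p 0 ^ 2 + p 1 ^ 2 < 1) (v w h : Fin 3 → ℝ) :
    fderiv ℝ (fun x => metric τ x v w) p h = metricDeriv τ p v w h := by
  obtain ⟨f, hf, hf'⟩ := hasFDerivAt_connectionForm τ hp v
  obtain ⟨k, hk, hk'⟩ := hasFDerivAt_connectionForm τ hp w
  have := (((hasFDerivAt_lam 0 1 hp).pow 2).mul_const (v 0 * w 0 + v 1 * w 1)).add (hf.mul hk)
  have h2 : HasFDerivAt (fun x => metric τ x v w) _ p := this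
  rw [h2.fderiv]
  simp [hf', hk', connectionForm_eq τ hp, metricDeriv]
  ring

/-- This is Koszul's formula for constant vector fields, whose brackets vanish. -/
theorem sum_christoffel (τ : ℝ) {p : Fin 3 → ℝ} (hp : p 0 ^ 2 + p 1 ^ 2 < 1) (v w n : Fin 3 → ℝ) :
    ∑ a, ∑ b, ∑ c, christoffel (metric τ) a b c p * v a * w b * n c
      = 1 / 2 * (metricDeriv τ p w n v + metricDeriv τ p v n w - metricDeriv τ p v w n) := by
  simp only [christoffel, fderiv_metric τ hp, Fin.sum_univ_three]
  simp [metricDeriv]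
  ring

/-! ### The flux argument in polar coordinates. -/

/-- If `P` and `Q` are the components of a vector field on the disk bounded by the conformal
factor `λ`, its divergence cannot be `c λ²` with `1 < c`. -/
theorem false_of_divergence_eq {P Q : (Fin 2 → ℝ) → ℝ} {c : ℝ} (hc : 1 < c)
    (hP : DifferentiableOn ℝ P disk) (hQ : DifferentiableOn ℝ Q disk)
    (hdiv : ∀ q ∈ disk, fderiv ℝ P q (Pi.single 0 1) + fderiv ℝ Q q (Pi.single 1 1)
      = c * lam (q 0) (q 1) ^ 2)
    (hb : ∀ q ∈ disk, P q ^ 2 + Q q ^ 2 ≤ lam (q 0) (q 1) ^ 2) : False := by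
  -- The final contradiction needs exactly `c * R > 1`.
  obtain ⟨R, hR, hR1⟩ : ∃ R, 1 / c < R ∧ R < 1 := exists_between (by
    rw [div_lt_one (by linarith)]; exact hc)
  have hR0 : 0 < R := lt_trans (by positivity) hR
  have hcR : 1 < c * R := by rwa [div_lt_iff₀' (by linarith)] at hR
  set γ : ℝ × ℝ → (Fin 2 → ℝ) := fun z => ![z.1 * Real.cos z.2, z.1 * Real.sin z.2] with hγ
  have hsq : ∀ z, (γ z 0) ^ 2 + (γ z 1) ^ 2 = z.1 ^ 2 := fun z => by
    simp [hγ]; linear_combination z.1 ^ 2 * Real.sin_sq_add_cos_sq z.2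
  have hγd : ∀ z : ℝ × ℝ, z ∈ Icc 0 R ×ˢ (univ : Set ℝ) → γ z ∈ disk := fun z hz => by
    have := hsq z
    simp only [disk, mem_ofPred_eq, this]
    have h1 := hz.1.1; have h2 := hz.1.2
    nlinarith
  have hlamγ : ∀ z, lam (γ z 0) (γ z 1) = lam z.1 0 := fun z => by
    simp only [lam, hsq]; simp
  have hγ' : ∀ z : ℝ × ℝ, ∃ f : ℝ × ℝ →L[ℝ] (Fin 2 → ℝ), HasFDerivAt γ f z ∧
      f (1, 0) = ![Real.cos z.2, Real.sin z.2] ∧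
      f (0, 1) = ![- (z.1 * Real.sin z.2), z.1 * Real.cos z.2] := fun z => by
    have h0 : HasFDerivAt (fun z : ℝ × ℝ => z.1 * Real.cos z.2) _ z :=
      hasFDerivAt_fst.mul hasFDerivAt_snd.cos
    have h1 : HasFDerivAt (fun z : ℝ × ℝ => z.1 * Real.sin z.2) _ z :=
      hasFDerivAt_fst.mul hasFDerivAt_snd.sin
    let d : Fin 2 → ℝ × ℝ →L[ℝ] ℝ :=
      ![z.1 • -Real.sin z.2 • ContinuousLinearMap.snd ℝ ℝ ℝ
          + Real.cos z.2 • ContinuousLinearMap.fst ℝ ℝ ℝ,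
        z.1 • Real.cos z.2 • ContinuousLinearMap.snd ℝ ℝ ℝ
          + Real.sin z.2 • ContinuousLinearMap.fst ℝ ℝ ℝ]
    have h : HasFDerivAt γ (ContinuousLinearMap.pi d) z :=
      hasFDerivAt_pi.2 (Fin.forall_fin_two.2 ⟨h0, h1⟩)
    refine ⟨_, h, ?_, ?_⟩ <;> ext i <;> fin_cases i <;> simp [d]
  -- With `z = (r, θ)`, `f` is `r` times the radial component minus `cλ(r)`, a primitive of `cλ²r`,
  -- and `g` is the angular component. Then `∂f/∂r + ∂g/∂θ = r (div - cλ²) = 0`. The divergence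
  -- theorem on a rectangle suffices, and the degenerate side `r = 0` only contributes `-cλ(0)`.
  set f : ℝ × ℝ → ℝ := fun z => z.1 * (P (γ z) * Real.cos z.2 + Q (γ z) * Real.sin z.2)
    - c * lam z.1 0 with hf
  set g : ℝ × ℝ → ℝ := fun z => Q (γ z) * Real.cos z.2 - P (γ z) * Real.sin z.2 with hg
  have key : ∀ z ∈ Icc 0 R ×ˢ (univ : Set ℝ), ∃ f' g' : ℝ × ℝ →L[ℝ] ℝ, HasFDerivAt f f' z ∧
      HasFDerivAt g g' z ∧ f' (1, 0) + g' (0, 1) = 0 := fun z hz => by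
    obtain ⟨d, hd, hd1, hd2⟩ := hγ' z
    have hm := hγd z hz
    have hPz := ((hP.differentiableAt (isOpen_disk.mem_nhds hm)).hasFDerivAt).comp z hd
    have hQz := ((hQ.differentiableAt (isOpen_disk.mem_nhds hm)).hasFDerivAt).comp z hd
    have hl : HasFDerivAt (fun z : ℝ × ℝ => lam z.1 0)
        ((lam z.1 0 ^ 2 * z.1) • ContinuousLinearMap.fst ℝ ℝ ℝ) z := by
      have hz1 : z.1 ^ 2 + 0 ^ 2 < 1 := by
        have := hsq z; simp only [disk, mem_ofPred_eq, this] at hm; linarith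
      have h0 : DifferentiableAt ℝ (fun x => lam x 0) z.1 := by
        unfold lam
        have : (1 - (z.1 ^ 2 + 0 ^ 2)) ≠ 0 := by linarith
        fun_prop (disch := assumption)
      have h1 := h0.hasDerivAt
      rw [deriv_lam_left hz1] at h1
      exact h1.comp_hasFDerivAt z hasFDerivAt_fst
    have hc' : HasFDerivAt (fun z : ℝ × ℝ => Real.cos z.2) _ z := hasFDerivAt_snd.cos
    have hs' : HasFDerivAt (fun z : ℝ × ℝ => Real.sin z.2) _ z := hasFDerivAt_snd.sin
    have hF := (hasFDerivAt_fst.mul ((hPz.mul hc').add (hQz.mul hs'))).sub (hl.const_mul c)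
    have hG := (hQz.mul hc').sub (hPz.mul hs')
    refine ⟨_, _, hF, hG, ?_⟩
    have hD := hdiv _ hm
    rw [hlamγ] at hD
    have e1 : ∀ a b : ℝ, (![a, b] : Fin 2 → ℝ) = a • Pi.single 0 1 + b • Pi.single 1 1 := by
      intro a b; ext i; fin_cases i <;> simp
    simp [hd1, hd2, e1]
    linear_combination z.1 * hD + z.1 * (fderiv ℝ P (γ z) (Pi.single 0 1)
      + fderiv ℝ Q (γ z) (Pi.single 1 1)) * Real.sin_sq_add_cos_sq z.2
  choose! f' g' hff hgg hsum using key
  have huI : ∀ z : ℝ × ℝ, z ∈ uIcc 0 R ×ˢ uIcc 0 (2 * Real.pi) →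
      z ∈ Icc 0 R ×ˢ (univ : Set ℝ) := fun z hz => by
    rw [uIcc_of_le hR0.le] at hz; exact ⟨hz.1, trivial⟩
  have hIoo : ∀ z : ℝ × ℝ, z ∈ Ioo (min 0 R) (max 0 R) ×ˢ
      Ioo (min 0 (2 * Real.pi)) (max 0 (2 * Real.pi)) → z ∈ Icc 0 R ×ˢ (univ : Set ℝ) :=
    fun z hz => huI z ⟨Ioo_subset_Icc_self hz.1, Ioo_subset_Icc_self hz.2⟩
  have hcont : ContinuousOn f (uIcc 0 R ×ˢ uIcc 0 (2 * Real.pi)) := fun z hz =>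
    (hff z (huI z hz)).continuousAt.continuousWithinAt
  have hdivthm := MeasureTheory.integral2_divergence_prod_of_hasFDerivAt_off_countable f g f' g' 0 0 R
    (2 * Real.pi) ∅ countable_empty hcont
    (fun z hz => (hgg z (huI z hz)).continuousAt.continuousWithinAt)
    (fun z hz => hff z (hIoo z hz.1))
    (fun z hz => hgg z (hIoo z hz.1))
    ((MeasureTheory.integrableOn_zero).congr_fun (fun z hz => (hsum z (huI z hz)).symm)
      (measurableSet_uIcc.prod measurableSet_uIcc))
  have hz0 : (∫ x in (0:ℝ)..R, ∫ y in (0:ℝ)..(2 * Real.pi), f' (x, y) (1, 0) + g' (x, y) (0, 1)) = 0 := by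
    rw [intervalIntegral.integral_congr (g := fun _ => 0)]
    · simp
    intro x hx
    simp only
    rw [intervalIntegral.integral_congr (g := fun _ => 0)]
    · simp
    intro y hy
    exact hsum _ (huI _ ⟨hx, hy⟩)
  -- By periodicity the two sides `θ = 0` and `θ = 2π` cancel, so `f` has the same integral over `r
  -- = R` as over `r = 0`.
  have hg0 : ∀ x, g (x, 2 * Real.pi) = g (x, 0) := fun x => by simp [hg, hγ]
  rw [hz0] at hdivthm
  simp only [hg0, sub_self, zero_add] at hdivthm
  have hfR : ∀ y, f (R, y) < f (0, y) := fun y => by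
    have hmem : γ (R, y) ∈ disk := hγd _ ⟨⟨hR0.le, le_rfl⟩, trivial⟩
    have h1 := hb _ hmem
    rw [hlamγ] at h1
    have hR2 : R ^ 2 + 0 ^ 2 < 1 := by nlinarith
    have hl := lam_pos hR2
    have hl2 : lam R 0 - lam 0 0 = lam R 0 * R ^ 2 := by
      have : (1 - (R ^ 2 + 0 ^ 2)) ≠ 0 := by linarith
      simp only [lam]; norm_num at this ⊢; field_simp; ring
    -- Cauchy–Schwarz: the square in the hint is that of the angular component.
    have h2 : P (γ (R, y)) * Real.cos y + Q (γ (R, y)) * Real.sin y ≤ lam R 0 := by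
      refine le_of_sq_le_sq ?_ hl.le
      have := Real.sin_sq_add_cos_sq y
      nlinarith [sq_nonneg (P (γ (R, y)) * Real.sin y - Q (γ (R, y)) * Real.cos y)]
    have h3 : R * (P (γ (R, y)) * Real.cos y + Q (γ (R, y)) * Real.sin y) ≤ R * lam R 0 :=
      mul_le_mul_of_nonneg_left h2 hR0.le
    have h4 : 0 < (c * R - 1) * (R * lam R 0) := by
      have : 0 < c * R - 1 := by linarith
      positivity
    simp only [hf]
    nlinarith
  have hcon : ∀ x ∈ Icc 0 R, ContinuousOn (fun y => f (x, y)) (Icc 0 (2 * Real.pi)) := fun x hx =>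
    hcont.comp (by fun_prop) (fun y hy => ⟨by rwa [uIcc_of_le hR0.le], by
      rwa [uIcc_of_le Real.two_pi_pos.le]⟩)
  have hlt := intervalIntegral.integral_lt_integral_of_continuousOn_of_le_of_exists_lt
    Real.two_pi_pos (hcon R ⟨hR0.le, le_rfl⟩) (hcon 0 ⟨le_rfl, hR0.le⟩) (fun y _ => (hfR y).le)
    ⟨0, ⟨le_rfl, Real.two_pi_pos.le⟩, hfR 0⟩
  linarith

/-! ### Mean curvature and coordinate derivatives of a graph. -/

/-- Cramer's rule for the 2 × 2 inverse. No nondegeneracy is needed, as both sides are `0` when the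
determinant vanishes. -/
theorem meanCurvature_eq (g : (Fin 3 → ℝ) → (Fin 3 → ℝ) → (Fin 3 → ℝ) → ℝ)
    (φ : (Fin 2 → ℝ) → (Fin 3 → ℝ)) (n : Fin 3 → ℝ) (q : Fin 2 → ℝ) :
    meanCurvature g φ n q = 1 / 2 * ((firstForm g φ q 1 1 * secondForm g φ n q 0 0
      - firstForm g φ q 0 1 * secondForm g φ n q 1 0
      - firstForm g φ q 1 0 * secondForm g φ n q 0 1
      + firstForm g φ q 0 0 * secondForm g φ n q 1 1)
      / (firstForm g φ q 0 0 * firstForm g φ q 1 1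
        - firstForm g φ q 0 1 * firstForm g φ q 1 0)) := by
  simp only [meanCurvature, Matrix.inv_def, Ring.inverse_eq_inv', Matrix.adjugate_fin_two,
    Matrix.det_fin_two, Matrix.trace_fin_two, Matrix.mul_apply, Fin.sum_univ_two,
    Matrix.smul_apply, smul_eq_mul, Matrix.of_apply, Matrix.cons_val', Matrix.cons_val_zero,
    Matrix.cons_val_one, Matrix.cons_val_fin_one]
  ring

theorem tangent_graphMap {u : (Fin 2 → ℝ) → ℝ} {q : Fin 2 → ℝ} (hu : DifferentiableAt ℝ u q)
    (i : Fin 2) : tangent (graphMap u) i q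
      = ![(Pi.single i 1 : Fin 2 → ℝ) 0, (Pi.single i 1 : Fin 2 → ℝ) 1,
          fderiv ℝ u q (Pi.single i 1)] := by
  let d : Fin 3 → (Fin 2 → ℝ) →L[ℝ] ℝ :=
    ![ContinuousLinearMap.proj (R := ℝ) (φ := fun _ => ℝ) 0,
      ContinuousLinearMap.proj (R := ℝ) (φ := fun _ => ℝ) 1, fderiv ℝ u q]
  have h : HasFDerivAt (graphMap u) (ContinuousLinearMap.pi d) q := by
    refine hasFDerivAt_pi.2 fun j => ?_
    fin_cases j
    · exact hasFDerivAt_apply 0 q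
    · exact hasFDerivAt_apply 1 q
    · exact hu.hasFDerivAt
  rw [tangent, h.fderiv]
  ext j
  fin_cases j <;> simp [d]

theorem differentiableAt_fderiv_apply {u : (Fin 2 → ℝ) → ℝ} {q : Fin 2 → ℝ}
    (hu : ContDiffAt ℝ 2 u q) (v : Fin 2 → ℝ) :
    DifferentiableAt ℝ (fun x => fderiv ℝ u x v) q :=
  ((hu.fderiv_right (m := 1) le_rfl).differentiableAt one_ne_zero).clm_apply
    (differentiableAt_const v)

theorem fderiv_tangent_graphMap {u : (Fin 2 → ℝ) → ℝ} {q : Fin 2 → ℝ} (hu : ContDiffAt ℝ 2 u q)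
    (i : Fin 2) (v : Fin 2 → ℝ) : fderiv ℝ (tangent (graphMap u) i) q v
      = ![0, 0, fderiv ℝ (fun x => fderiv ℝ u x (Pi.single i 1)) q v] := by
  have hev : tangent (graphMap u) i =ᶠ[nhds q] fun x =>
      ![(Pi.single i 1 : Fin 2 → ℝ) 0, (Pi.single i 1 : Fin 2 → ℝ) 1,
        fderiv ℝ u x (Pi.single i 1)] := by
    filter_upwards [hu.eventually (by simp)] with x hx
    exact tangent_graphMap (hx.differentiableAt two_ne_zero) i
  let d : Fin 3 → (Fin 2 → ℝ) →L[ℝ] ℝ :=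
    ![0, 0, fderiv ℝ (fun x => fderiv ℝ u x (Pi.single i 1)) q]
  have h : HasFDerivAt (fun x => ![(Pi.single i 1 : Fin 2 → ℝ) 0, (Pi.single i 1 : Fin 2 → ℝ) 1,
      fderiv ℝ u x (Pi.single i 1)]) (ContinuousLinearMap.pi d) q := by
    refine hasFDerivAt_pi.2 fun j => ?_
    fin_cases j
    · exact hasFDerivAt_const _ q
    · exact hasFDerivAt_const _ q
    · exact (differentiableAt_fderiv_apply hu _).hasFDerivAt
  rw [hev.fderiv_eq, h.fderiv]
  ext j
  fin_cases j <;> simp [d]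

theorem fderiv_fderiv_apply_comm {u : (Fin 2 → ℝ) → ℝ} {q : Fin 2 → ℝ}
    (hu : ContDiffAt ℝ 2 u q) (v w : Fin 2 → ℝ) :
    fderiv ℝ (fun x => fderiv ℝ u x v) q w = fderiv ℝ (fun x => fderiv ℝ u x w) q v := by
  have hd : DifferentiableAt ℝ (fderiv ℝ u) q :=
    (hu.fderiv_right (m := 1) le_rfl).differentiableAt one_ne_zero
  have hs : IsSymmSndFDerivAt ℝ u q := hu.isSymmSndFDerivAt (by simp)
  have key : ∀ v w, fderiv ℝ (fun x => fderiv ℝ u x v) q w = fderiv ℝ (fderiv ℝ u) q w v := by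
    intro v w
    rw [fderiv_clm_apply hd (differentiableAt_const v)]
    simp
  rw [key, key, hs.eq]

/-! ### The flux field and the mean curvature equation. -/

/-- The component `u_x + 2τλy` of the horizontal gradient of the graph. -/
def slopeX (τ : ℝ) (u : (Fin 2 → ℝ) → ℝ) (q : Fin 2 → ℝ) : ℝ :=
  fderiv ℝ u q (Pi.single 0 1) + 2 * τ * (lam (q 0) (q 1) * q 1)

/-- The component `u_y - 2τλx` of the horizontal gradient of the graph. -/
def slopeY (τ : ℝ) (u : (Fin 2 → ℝ) → ℝ) (q : Fin 2 → ℝ) : ℝ :=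
  fderiv ℝ u q (Pi.single 1 1) - 2 * τ * (lam (q 0) (q 1) * q 0)

/-- `λ W`, where `W` is the area element of the graph relative to the hyperbolic plane. -/
def areaFactor (τ : ℝ) (u : (Fin 2 → ℝ) → ℝ) (q : Fin 2 → ℝ) : ℝ :=
  √(lam (q 0) (q 1) ^ 2 + slopeX τ u q ^ 2 + slopeY τ u q ^ 2)

/-- The first component `u_x + 2τλy`, divided by `W`, of the field whose divergence is `± 2Hλ²`. -/
def fluxX (τ : ℝ) (u : (Fin 2 → ℝ) → ℝ) (q : Fin 2 → ℝ) : ℝ :=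
  lam (q 0) (q 1) * slopeX τ u q * (areaFactor τ u q)⁻¹

/-- The second component of the field whose divergence is `± 2Hλ²`. -/
def fluxY (τ : ℝ) (u : (Fin 2 → ℝ) → ℝ) (q : Fin 2 → ℝ) : ℝ :=
  lam (q 0) (q 1) * slopeY τ u q * (areaFactor τ u q)⁻¹

theorem fluxX_sq_add_fluxY_sq_le (τ : ℝ) (u : (Fin 2 → ℝ) → ℝ) {q : Fin 2 → ℝ} (hq : q ∈ disk) :
    fluxX τ u q ^ 2 + fluxY τ u q ^ 2 ≤ lam (q 0) (q 1) ^ 2 := by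
  have hl := lam_pos hq
  have hS : 0 < lam (q 0) (q 1) ^ 2 + slopeX τ u q ^ 2 + slopeY τ u q ^ 2 := by positivity
  simp only [fluxX, fluxY, areaFactor, mul_pow, inv_pow, Real.sq_sqrt hS.le]
  rw [← add_mul, ← div_eq_mul_inv, div_le_iff₀ hS]
  nlinarith [sq_nonneg (lam (q 0) (q 1) ^ 2)]

theorem lam_contDiffAt {q : Fin 2 → ℝ} (hq : q ∈ disk) :
    ContDiffAt ℝ 1 (fun q : Fin 2 → ℝ => lam (q 0) (q 1)) q := by
  have : 1 - (q 0 ^ 2 + q 1 ^ 2) ≠ 0 := by have : q 0 ^ 2 + q 1 ^ 2 < 1 := hq; linarith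
  unfold lam
  fun_prop (disch := assumption)

theorem contDiffAt_flux (τ : ℝ) {u : (Fin 2 → ℝ) → ℝ} {q : Fin 2 → ℝ} (hq : q ∈ disk)
    (hu : ContDiffAt ℝ 2 u q) : ContDiffAt ℝ 1 (fluxX τ u) q ∧ ContDiffAt ℝ 1 (fluxY τ u) q := by
  have hl := lam_contDiffAt hq
  have hu' : ContDiffAt ℝ 1 (fderiv ℝ u) q := hu.fderiv_right le_rfl
  have hX : ContDiffAt ℝ 1 (slopeX τ u) q := by unfold slopeX; fun_prop
  have hY : ContDiffAt ℝ 1 (slopeY τ u) q := by unfold slopeY; fun_prop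
  have hp := lam_pos hq
  have hS : 0 < lam (q 0) (q 1) ^ 2 + slopeX τ u q ^ 2 + slopeY τ u q ^ 2 := by positivity
  have hW : ContDiffAt ℝ 1 (areaFactor τ u) q :=
    (((hl.pow 2).add (hX.pow 2)).add (hY.pow 2)).sqrt hS.ne'
  have hW0 : areaFactor τ u q ≠ 0 := (Real.sqrt_pos.2 hS).ne'
  exact ⟨(hl.mul hX).mul (hW.inv hW0), (hl.mul hY).mul (hW.inv hW0)⟩

/-- Quotient rule, with the root `s` and the second derivatives `A`, `B`, `C` of `u` named so that
the result is a rational expression to compare with the mean curvature. -/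
theorem divergence_flux (τ : ℝ) {u : (Fin 2 → ℝ) → ℝ} {q : Fin 2 → ℝ} (hq : q ∈ disk)
    (hu : ContDiffAt ℝ 2 u q) {l x y a b A B C s : ℝ} 
    (hx : q 0 = x) (hy : q 1 = y) (hl : lam x y = l) (ha : slopeX τ u q = a) (hb : slopeY τ u q = b)
    (hA : fderiv ℝ (fun x => fderiv ℝ u x (Pi.single 0 1)) q (Pi.single 0 1) = A)
    (hB : fderiv ℝ (fun x => fderiv ℝ u x (Pi.single 0 1)) q (Pi.single 1 1) = B)
    (hC : fderiv ℝ (fun x => fderiv ℝ u x (Pi.single 1 1)) q (Pi.single 1 1) = C)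
    (hs : areaFactor τ u q = s) :
    fderiv ℝ (fluxX τ u) q (Pi.single 0 1) + fderiv ℝ (fluxY τ u) q (Pi.single 1 1)
      = ((l ^ 2 * (x * a + y * b) + l * (A + C)) * s ^ 2
        - l * a * (l ^ 3 * x + a * (A + 2 * τ * (l ^ 2 * x * y))
            + b * (B - 2 * τ * (l ^ 2 * x * x + l)))
        - l * b * (l ^ 3 * y + a * (B + 2 * τ * (l ^ 2 * y * y + l))
            + b * (C - 2 * τ * (l ^ 2 * x * y)))) / s ^ 3 := by
  have hL := hasFDerivAt_lam 0 1 (show q 0 ^ 2 + q 1 ^ 2 < 1 from hq)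
  have h0 : HasFDerivAt (fun x : Fin 2 → ℝ => x 0)
    (ContinuousLinearMap.proj (R := ℝ) (φ := fun _ => ℝ) 0) q := hasFDerivAt_apply 0 q
  have h1 : HasFDerivAt (fun x : Fin 2 → ℝ => x 1)
    (ContinuousLinearMap.proj (R := ℝ) (φ := fun _ => ℝ) 1) q := hasFDerivAt_apply 1 q
  have hX : HasFDerivAt (slopeX τ u) _ q :=
    (differentiableAt_fderiv_apply hu (Pi.single 0 1)).hasFDerivAt.add
      ((hL.mul h1).const_mul (2 * τ))
  have hY : HasFDerivAt (slopeY τ u) _ q :=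
    (differentiableAt_fderiv_apply hu (Pi.single 1 1)).hasFDerivAt.sub
      ((hL.mul h0).const_mul (2 * τ))
  have hp := lam_pos hq
  have hS : 0 < lam (q 0) (q 1) ^ 2 + slopeX τ u q ^ 2 + slopeY τ u q ^ 2 := by positivity
  have hW : HasFDerivAt (areaFactor τ u) _ q :=
    (((hL.pow 2).add (hX.pow 2)).add (hY.pow 2)).sqrt hS.ne'
  have hW0 : areaFactor τ u q ≠ 0 := (Real.sqrt_pos.2 hS).ne'
  have hI := (hasDerivAt_inv hW0).comp_hasFDerivAt q hW
  have hPX : HasFDerivAt (fluxX τ u) _ q := (hL.mul hX).mul hI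
  have hPY : HasFDerivAt (fluxY τ u) _ q := (hL.mul hY).mul hI
  have hs' : √(l ^ 2 + a ^ 2 + b ^ 2) = s := by rw [← hs, areaFactor, hx, hy, hl, ha, hb]
  have hs0 : s ≠ 0 := hs ▸ hW0
  have hB' := fderiv_fderiv_apply_comm hu (Pi.single 1 1) (Pi.single 0 1)
  rw [hB] at hB'
  rw [hPX.fderiv, hPY.fderiv]
  simp [hl, ha, hb, hs, hs', hx, hy, hA, hB, hC, hB']
  field_simp
  ring

/-- The mean curvature equation `div X = ± 2Hλ²`, whose sign depends on the normal. -/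
theorem sq_divergence_flux (τ : ℝ) {u : (Fin 2 → ℝ) → ℝ} {q : Fin 2 → ℝ} (hq : q ∈ disk)
    (hu : ContDiffAt ℝ 2 u q) {n : Fin 3 → ℝ} (hn : metric τ (graphMap u q) n n = 1)
    (ht : ∀ i, metric τ (graphMap u q) (tangent (graphMap u) i q) n = 0) :
    (fderiv ℝ (fluxX τ u) q (Pi.single 0 1) + fderiv ℝ (fluxY τ u) q (Pi.single 1 1)) ^ 2
      = (2 * meanCurvature (metric τ) (graphMap u) n q * lam (q 0) (q 1) ^ 2) ^ 2 := by
  have hp : graphMap u q 0 ^ 2 + graphMap u q 1 ^ 2 < 1 := hq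
  have hd := hu.differentiableAt two_ne_zero
  have e0 : graphMap u q 0 = q 0 := rfl
  have e1 : graphMap u q 1 = q 1 := rfl
  have hl0 := lam_pos hq
  have hS : 0 < lam (q 0) (q 1) ^ 2 + slopeX τ u q ^ 2 + slopeY τ u q ^ 2 := by positivity
  have hs0 : 0 < areaFactor τ u q := Real.sqrt_pos.2 hS
  have hs2 : areaFactor τ u q ^ 2 = _ := Real.sq_sqrt hS.le
  obtain ⟨a, ha⟩ : ∃ a, slopeX τ u q = a := ⟨_, rfl⟩
  obtain ⟨b, hb⟩ : ∃ b, slopeY τ u q = b := ⟨_, rfl⟩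
  have hux : fderiv ℝ u q (Pi.single 0 1) = a - 2 * τ * (lam (q 0) (q 1) * q 1) := by
    rw [← ha, slopeX]; ring
  have huy : fderiv ℝ u q (Pi.single 1 1) = b + 2 * τ * (lam (q 0) (q 1) * q 0) := by
    rw [← hb, slopeY]; ring
  have hB' := fderiv_fderiv_apply_comm hu (Pi.single 1 1) (Pi.single 0 1)
  have ht0 := ht 0
  have ht1 := ht 1
  rw [divergence_flux τ hq hu rfl rfl rfl ha hb rfl rfl rfl rfl, meanCurvature_eq]
  simp only [firstForm, secondForm, Matrix.of_apply, sum_christoffel τ hp,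
    fderiv_tangent_graphMap hu, tangent_graphMap hd, metric, connectionForm_eq τ hp, metricDeriv,
    e0, e1, hux, huy, hB', ha, hb] at hn ht0 ht1 hs2 ⊢
  generalize fderiv ℝ (fun x => fderiv ℝ u x (Pi.single 0 1)) q (Pi.single 0 1) = A
  generalize fderiv ℝ (fun x => fderiv ℝ u x (Pi.single 0 1)) q (Pi.single 1 1) = B
  generalize fderiv ℝ (fun x => fderiv ℝ u x (Pi.single 1 1)) q (Pi.single 1 1) = C
  generalize areaFactor τ u q = s at *
  generalize lam (q 0) (q 1) = l at *
  generalize q 0 = x at *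
  generalize q 1 = y at *
  simp [-one_div] at ht0 ht1 ⊢
  generalize n 0 = n0 at *
  generalize n 1 = n1 at *
  generalize n 2 = n2 at *
  -- `w` is the vertical component of the normal. Tangency conditions give the horizontal components
  -- in terms of `w`, and unit length then forces `w = ± l / s`.
  obtain ⟨w, hw⟩ : ∃ w, 2 * τ * (l * (y * n0 - x * n1)) + n2 = w := ⟨_, rfl⟩
  rw [hw] at hn ht0 ht1 ⊢
  have hn0 : n0 = -(a * w) / l ^ 2 := by rw [eq_div_iff (by positivity)]; linarith
  have hn1 : n1 = -(b * w) / l ^ 2 := by rw [eq_div_iff (by positivity)]; linarith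
  have hws : (w * s / l) ^ 2 = 1 := by
    rw [hn0, hn1] at hn
    field_simp at hn ⊢
    rw [hs2]
    linarith
  have hdet : (l ^ 2 + a * a) * (l ^ 2 + b * b) - a * b * (b * a) = l ^ 2 * s ^ 2 := by
    rw [hs2]; ring
  have hs4 : s ^ 3 = s * (l ^ 2 + a ^ 2 + b ^ 2) := by rw [← hs2]; ring
  -- The mean curvature is linear in `w`. Inserting the sign `w * s / l` on the divergence side
  -- makes both bases linear in `w`, so they agree without a case split.
  have hmul : ∀ z : ℝ, z ^ 2 = (w * s / l * z) ^ 2 := fun z => by rw [mul_pow, hws, one_mul]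
  rw [hdet, hmul]
  congr 1
  rw [hn0, hn1, hs4, hs2]
  field_simp
  ring

/-! ### Constancy of the sign, and conclusion. -/

/-- No entire graph has constant mean curvature larger than `1 / 2`. -/
theorem not_hasConstantMeanCurvature {τ H : ℝ} (hH : 1 / 2 < H) {u : (Fin 2 → ℝ) → ℝ}
    (hu : ContDiffOn ℝ 2 u disk) :
    ¬ HasConstantMeanCurvature (metric τ) disk (graphMap u) H := by
  rintro ⟨N, -, hN⟩
  have hu' : ∀ q ∈ disk, ContDiffAt ℝ 2 u q := fun q hq =>
    hu.contDiffAt (isOpen_disk.mem_nhds hq)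
  have hX : ContDiffOn ℝ 1 (fluxX τ u) disk := fun q hq =>
    (contDiffAt_flux τ hq (hu' q hq)).1.contDiffWithinAt
  have hY : ContDiffOn ℝ 1 (fluxY τ u) disk := fun q hq =>
    (contDiffAt_flux τ hq (hu' q hq)).2.contDiffWithinAt
  have hsq : EqOn ((fun q => fderiv ℝ (fluxX τ u) q (Pi.single 0 1)
      + fderiv ℝ (fluxY τ u) q (Pi.single 1 1)) ^ 2)
      ((fun q => 2 * H * lam (q 0) (q 1) ^ 2) ^ 2) disk := fun q hq => by
    obtain ⟨h1, h2, h3⟩ := hN q hq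
    have := sq_divergence_flux τ hq (hu' q hq) h1 h2
    rw [h3] at this
    exact this
  have hpre : IsPreconnected disk := by
    have : StarConvex ℝ 0 disk := by
      rw [starConvex_zero_iff]
      intro q hq a ha0 ha1
      have hq' : q 0 ^ 2 + q 1 ^ 2 < 1 := hq
      show (a * q 0) ^ 2 + (a * q 1) ^ 2 < 1
      nlinarith [sq_nonneg (q 0), sq_nonneg (q 1), mul_le_one₀ ha1 ha0 ha1,
        mul_nonneg (sub_nonneg.2 (mul_le_one₀ ha1 ha0 ha1))
          (add_nonneg (sq_nonneg (q 0)) (sq_nonneg (q 1)))]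
    exact (this.isPathConnected (by simp [disk])).isConnected.isPreconnected
  have hcd : ContinuousOn (fun q => fderiv ℝ (fluxX τ u) q (Pi.single 0 1)
      + fderiv ℝ (fluxY τ u) q (Pi.single 1 1)) disk :=
    ((hX.continuousOn_fderiv_of_isOpen isOpen_disk le_rfl).clm_apply continuousOn_const).add
      ((hY.continuousOn_fderiv_of_isOpen isOpen_disk le_rfl).clm_apply continuousOn_const)
  have hcl : ContinuousOn (fun q : Fin 2 → ℝ => 2 * H * lam (q 0) (q 1) ^ 2) disk := fun q hq =>
    ((lam_contDiffAt hq).continuousAt.pow 2).const_mul (2 * H) |>.continuousWithinAt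
  have hne : ∀ {q : Fin 2 → ℝ}, q ∈ disk → 2 * H * lam (q 0) (q 1) ^ 2 ≠ 0 := fun hq => by
    have := lam_pos hq
    have : 0 < H := by linarith
    positivity
  have hXd := hX.differentiableOn one_ne_zero
  have hYd := hY.differentiableOn one_ne_zero
  -- Two continuous functions with equal squares, one of them without zeros, agree up to one global
  -- sign on a preconnected set.
  rcases hpre.eq_or_eq_neg_of_sq_eq hcd hcl hsq hne with h | h
  · exact false_of_divergence_eq (c := 2 * H) (by linarith) hXd hYd (fun q hq => h hq)
      fun q hq => fluxX_sq_add_fluxY_sq_le τ u hq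
  · refine false_of_divergence_eq (c := 2 * H) (by linarith) hXd.neg hYd.neg (fun q hq => ?_)
      fun q hq => by simpa using fluxX_sq_add_fluxY_sq_le τ u hq
    have := h hq
    simp only [Pi.neg_apply] at this
    rw [fderiv_neg, fderiv_neg]
    simp only [neg_apply]
    linarith

end PSL2

end

theorem proposition11p1 (τ H : ℝ) (hH : 1 / 2 < H) :
    ¬ ∃ u : (Fin 2 → ℝ) → ℝ, ContDiffOn ℝ 2 u PSL2.disk ∧
      PSL2.HasConstantMeanCurvature (PSL2.metric τ) PSL2.disk (PSL2.graphMap u) H := by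
  rintro ⟨u, hu, h⟩
  exact PSL2.not_hasConstantMeanCurvature hH hu h
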